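/- Let $X$ be a metric space. For a family $\mathcal U$ of subsets of $X$ and $x\in X$ let $L_{\mathcal U}(x)=\sup_{U\in\mathcal U}\operatorname{dist}(x,X\setminus U)\in[0,\infty]$ (with $\operatorname{dist}(x,\emptyset)=\infty$, and $L_{\mathcal U}\equiv 0$ for the empty family). The family $\mathcal U$ is called coarse if $L_{\mathcal U}(x)\to\infty$ as $x\to\infty$ in $X$, i.e. if for every $t<\infty$ there is a bounded set $K\subset X$ with $L_{\mathcal U}(x)>t$ for all $x\in X\setminus K$. A coarse refinement of a family $\mathcal U$ is a coarse family $\mathcal V$ such that every $V\in\mathcal V$ is contained in some $U\in\mathcal U$. The multiplicity of $\mathcal V$ is the supremum over $x\in X$ of the number of elements of $\mathcal V$ that contain $x$. The coarse dimension of $X$ is the smallest integer $n\ge -1$ such that every finite coarse family in $X$ has a coarse refinement of multiplicity at most $n+1$, and it is $\infty$ if there is no such $n$. (It is $-1$ if $X$ is bounded.) Let $A$ and $B$ be subsets of $X$, with the restricted metrics. If $X=A\cup B$, then the coarse dimension of $X$ equals the maximum of the coarse dimensions of $A$ and $B$. -/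

import Mathlib

namespace CoarseUnion

open Filter Topology

/-- The local Lebesgue number of a family `𝒰` of subsets of `X` at `x`: the supremum over
`U ∈ 𝒰` of the distance from `x` to `X \ U`, with values in `[0, ∞]`. The distance to the empty
set is `∞`, so the value is `∞` when `X ∈ 𝒰`; it is `0` for the empty family. -/
noncomputable def localLebesgue {X : Type*} [MetricSpace X] (𝒰 : Set (Set X)) (x : X) : ENNReal :=
  ⨆ U ∈ 𝒰, Metric.infEDist x Uᶜ

/-- A family of subsets is coarse if its local Lebesgue number is coarsely proper, that is, tends
to `∞` as the point goes to infinity (leaves every bounded subset of `X`). -/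
def IsCoarseFamily {X : Type*} [MetricSpace X] (𝒰 : Set (Set X)) : Prop :=
  Tendsto (localLebesgue 𝒰) (Bornology.cobounded X) (𝓝 ⊤)

/-- The number (possibly `∞`) of elements of the family `𝒰` that contain `x`. -/
noncomputable def multiplicityAt {X : Type*} (𝒰 : Set (Set X)) (x : X) : ℕ∞ :=
  {U | U ∈ 𝒰 ∧ x ∈ U}.encard

/-- The global multiplicity of the family `𝒰`. -/
noncomputable def familyMultiplicity {X : Type*} (𝒰 : Set (Set X)) : ℕ∞ :=
  ⨆ x : X, multiplicityAt 𝒰 x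

/-- `𝒱` is a coarse refinement of `𝒰`: it is a coarse family, each element of which is contained
in an element of `𝒰`. -/
def IsCoarseRefinement {X : Type*} [MetricSpace X] (𝒱 𝒰 : Set (Set X)) : Prop :=
  IsCoarseFamily 𝒱 ∧ ∀ V ∈ 𝒱, ∃ U ∈ 𝒰, V ⊆ U

/-- Every finite coarse family in `X` has a coarse refinement of multiplicity at most `n + 1`.
(Multiplicities are nonnegative, so this fails for `n < -1`.) -/
def HasCoarseDimLE (X : Type*) [MetricSpace X] (n : ℤ) : Prop :=
  ∃ k : ℕ, (k : ℤ) = n + 1 ∧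
    ∀ 𝒰 : Set (Set X), 𝒰.Finite → IsCoarseFamily 𝒰 →
      ∃ 𝒱 : Set (Set X), IsCoarseRefinement 𝒱 𝒰 ∧ familyMultiplicity 𝒱 ≤ k

/-- The coarse dimension of `X`: the smallest integer `n` such that every finite coarse family
in `X` has a coarse refinement of multiplicity at most `n + 1`, and `∞` if there is none. -/
noncomputable def coarseDim (X : Type*) [MetricSpace X] : WithTop ℤ :=
  sInf {d | ∃ n : ℤ, d = (n : WithTop ℤ) ∧ HasCoarseDimLE X n}

end CoarseUnion

/-!
Call `A ⊆ X` good for `k` if every finite coarse family in `X` has a coarse refinement whose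
multiplicity at the points of `A` is at most `k`. Assigning each member of a refinement of a
finite family to a member of that family containing it, and merging those with the same
assignment, gives a finite refinement whose multiplicity is at most that of both. Hence refining
first for `A` and then for `B` shows that a union of two good sets is good.

It remains to see that goodness of `A` in `X` is the bound `k - 1` on the coarse dimension of `A`.
The difficulty is to extend to `X` a coarse refinement that lives only on `A`. For this the finite
family is first shrunk to the sets of points where a given member realizes the local Lebesgue
number up to a factor `2`: far away, such points have large balls inside that member, so a
refinement of the shrunken family on `A` may be thickened by the points outside `A`, where
multiplicities are not controlled.
-/

namespace CoarseUnion

open Bornology Filter Metric Set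
open scoped ENNReal NNReal

section LocalLebesgue

variable {X : Type*} [MetricSpace X] {𝒰 𝒱 : Set (Set X)} {U : Set X} {x y : X}

lemma eball_subset_iff_le_infEDist_compl {r : ℝ≥0∞} : eball x r ⊆ U ↔ r ≤ infEDist x Uᶜ := by
  rw [le_infEDist, ← compl_subset_compl]
  exact forall₂_congr fun y _ => by rw [mem_compl_iff, mem_eball', not_lt]

lemma infEDist_compl_le_localLebesgue (hU : U ∈ 𝒰) : infEDist x Uᶜ ≤ localLebesgue 𝒰 x :=
  le_iSup₂ (f := fun V (_ : V ∈ 𝒰) => infEDist x Vᶜ) U hU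

lemma localLebesgue_le_add_edist : localLebesgue 𝒰 x ≤ localLebesgue 𝒰 y + edist x y :=
  iSup₂_le fun _ hU => infEDist_le_infEDist_add_edist.trans <| by
    gcongr; exact infEDist_compl_le_localLebesgue hU

lemma lt_localLebesgue_iff {r : ℝ≥0∞} :
    r < localLebesgue 𝒰 x ↔ ∃ U ∈ 𝒰, r < infEDist x Uᶜ := by
  simp only [localLebesgue, lt_iSup_iff, exists_prop]

lemma exists_infEDist_compl_eq_localLebesgue (hfin : 𝒰.Finite) (hne : 𝒰.Nonempty) :
    ∃ U ∈ 𝒰, infEDist x Uᶜ = localLebesgue 𝒰 x := by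
  obtain ⟨U, hU, hmax⟩ := exists_max_image 𝒰 (fun U => infEDist x Uᶜ) hfin hne
  exact ⟨U, hU, (infEDist_compl_le_localLebesgue hU).antisymm (iSup₂_le hmax)⟩

lemma isCoarseFamily_iff_eventually_lt :
    IsCoarseFamily 𝒰 ↔ ∀ t : ℝ≥0, ∀ᶠ x in cobounded X, t < localLebesgue 𝒰 x :=
  ENNReal.tendsto_nhds_top_iff_nnreal

lemma isCoarseFamily_iff_eventually_eball_subset :
    IsCoarseFamily 𝒰 ↔
      ∀ t : ℝ≥0, ∀ᶠ x in cobounded X, ∃ U ∈ 𝒰, eball x t ⊆ U := by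
  rw [isCoarseFamily_iff_eventually_lt]
  refine ⟨fun h t => ?_, fun h t => ?_⟩
  · filter_upwards [h t] with x hx
    obtain ⟨U, hU, hlt⟩ := lt_localLebesgue_iff.1 hx
    exact ⟨U, hU, eball_subset_iff_le_infEDist_compl.2 hlt.le⟩
  · filter_upwards [h (t + 1)] with x ⟨U, hU, hball⟩
    calc (t : ℝ≥0∞) < (t + 1 : ℝ≥0) := by exact_mod_cast lt_add_one t
      _ ≤ infEDist x Uᶜ := eball_subset_iff_le_infEDist_compl.1 hball
      _ ≤ localLebesgue 𝒰 x := infEDist_compl_le_localLebesgue hU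

lemma isCoarseFamily_singleton_univ : IsCoarseFamily {(univ : Set X)} :=
  isCoarseFamily_iff_eventually_eball_subset.2 fun _ =>
    Eventually.of_forall fun _ => ⟨univ, rfl, subset_univ _⟩

lemma IsCoarseFamily.of_forall_exists_superset (h𝒰 : IsCoarseFamily 𝒰)
    (h : ∀ U ∈ 𝒰, ∃ V ∈ 𝒱, U ⊆ V) : IsCoarseFamily 𝒱 := by
  rw [isCoarseFamily_iff_eventually_eball_subset] at h𝒰 ⊢
  intro t
  filter_upwards [h𝒰 t] with x ⟨U, hU, hball⟩
  obtain ⟨V, hV, hUV⟩ := h U hU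
  exact ⟨V, hV, hball.trans hUV⟩

end LocalLebesgue

section DeepPart

variable {X : Type*} [MetricSpace X] {𝒰 : Set (Set X)}

/-- The points of `U` at which `U` realizes the local Lebesgue number of `𝒰` up to a factor `2`.
Replacing each member of a finite coarse family by its deep part gives a coarse refinement whose
members, far away, have arbitrarily large collars inside the original ones. -/
def deepPart (𝒰 : Set (Set X)) (U : Set X) : Set X :=
  {x ∈ U | localLebesgue 𝒰 x ≤ 2 * infEDist x Uᶜ}

lemma deepPart_subset (U : Set X) : deepPart 𝒰 U ⊆ U :=
  sep_subset _ _

lemma IsCoarseFamily.eventually_eball_subset_of_mem_deepPart (h𝒰 : IsCoarseFamily 𝒰) (t : ℝ≥0) :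
    ∀ᶠ x in cobounded X, ∀ U, x ∈ deepPart 𝒰 U → eball x t ⊆ U := by
  filter_upwards [isCoarseFamily_iff_eventually_lt.1 h𝒰 (2 * t)] with x hx U hxU
  rw [eball_subset_iff_le_infEDist_compl]
  have h2 : 2 * (t : ℝ≥0∞) ≤ 2 * infEDist x Uᶜ := by
    exact_mod_cast hx.le.trans hxU.2
  exact (ENNReal.mul_le_mul_iff_right two_ne_zero ENNReal.ofNat_ne_top).1 h2

lemma eball_subset_deepPart {U : Set X} {x : X} {t : ℝ≥0∞}
    (hmax : infEDist x Uᶜ = localLebesgue 𝒰 x) (ht : 3 * t ≤ localLebesgue 𝒰 x) :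
    eball x t ⊆ deepPart 𝒰 U := by
  intro y hy
  have h3 : 3 * edist x y ≤ infEDist x Uᶜ := by
    rw [hmax]
    refine le_trans ?_ ht
    gcongr
    exact (mem_eball'.1 hy).le
  have hinf : infEDist x Uᶜ ≤ infEDist y Uᶜ + edist x y := infEDist_le_infEDist_add_edist
  have h2 : 2 * edist x y ≤ infEDist y Uᶜ := by
    refine (ENNReal.add_le_add_iff_right (edist_ne_top x y)).1 ?_
    calc 2 * edist x y + edist x y = 3 * edist x y := by ring
      _ ≤ infEDist y Uᶜ + edist x y := h3.trans hinf
  refine ⟨?_, ?_⟩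
  · refine eball_subset_iff_le_infEDist_compl.2 ?_ hy
    rw [hmax]
    refine le_trans ?_ ht
    exact le_mul_of_one_le_left' (by norm_num)
  · calc localLebesgue 𝒰 y ≤ localLebesgue 𝒰 x + edist y x := localLebesgue_le_add_edist
      _ ≤ (infEDist y Uᶜ + edist x y) + edist x y := by
        rw [edist_comm y x]; gcongr; exact hmax ▸ hinf
      _ = infEDist y Uᶜ + 2 * edist x y := by ring
      _ ≤ infEDist y Uᶜ + infEDist y Uᶜ := by gcongr
      _ = 2 * infEDist y Uᶜ := (two_mul _).symm

lemma IsCoarseFamily.image_deepPart (h𝒰 : IsCoarseFamily 𝒰) (hfin : 𝒰.Finite) :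
    IsCoarseFamily (deepPart 𝒰 '' 𝒰) := by
  rw [isCoarseFamily_iff_eventually_eball_subset]
  intro t
  filter_upwards [isCoarseFamily_iff_eventually_lt.1 h𝒰 (3 * t)] with x hx
  have hne : 𝒰.Nonempty := (lt_localLebesgue_iff.1 hx).imp fun _ => And.left
  obtain ⟨U, hU, hmax⟩ := exists_infEDist_compl_eq_localLebesgue (x := x) hfin hne
  exact ⟨_, mem_image_of_mem _ hU, eball_subset_deepPart hmax (by exact_mod_cast hx.le)⟩

end DeepPart

section Multiplicity

variable {X Y : Type*} {𝒰 : Set (Set X)} {𝒱 : Set (Set Y)} {x : X} {y : Y}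

lemma multiplicityAt_le_of_forall_exists_eq (φ : Set Y → Set X)
    (h : ∀ U ∈ 𝒰, x ∈ U → ∃ V ∈ 𝒱, y ∈ V ∧ φ V = U) :
    multiplicityAt 𝒰 x ≤ multiplicityAt 𝒱 y := by
  refine (encard_le_encard (t := φ '' {V | V ∈ 𝒱 ∧ y ∈ V}) ?_).trans (encard_image_le _ _)
  rintro U ⟨hU, hx⟩
  obtain ⟨V, hV, hy, rfl⟩ := h U hU hx
  exact mem_image_of_mem φ ⟨hV, hy⟩

lemma multiplicityAt_image_preimage_le (f : X → Y) (x : X) :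
    multiplicityAt (preimage f '' 𝒱) x ≤ multiplicityAt 𝒱 (f x) :=
  multiplicityAt_le_of_forall_exists_eq (preimage f) <| by
    rintro _ ⟨V, hV, rfl⟩ hx
    exact ⟨V, hV, hx, rfl⟩

end Multiplicity

section Refinement

variable {X : Type*} [MetricSpace X] {𝒰 𝒱 𝒲 : Set (Set X)}

lemma IsCoarseRefinement.trans (h₁ : IsCoarseRefinement 𝒲 𝒱) (h₂ : IsCoarseRefinement 𝒱 𝒰) :
    IsCoarseRefinement 𝒲 𝒰 := by
  refine ⟨h₁.1, fun W hW => ?_⟩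
  obtain ⟨V, hV, hWV⟩ := h₁.2 W hW
  obtain ⟨U, hU, hVU⟩ := h₂.2 V hV
  exact ⟨U, hU, hWV.trans hVU⟩

lemma IsCoarseRefinement.exists_finite_multiplicityAt_le (h : IsCoarseRefinement 𝒱 𝒰)
    (hfin : 𝒰.Finite) :
    ∃ 𝒲, 𝒲.Finite ∧ IsCoarseRefinement 𝒲 𝒰 ∧
      ∀ x, multiplicityAt 𝒲 x ≤ multiplicityAt 𝒱 x ∧ multiplicityAt 𝒲 x ≤ multiplicityAt 𝒰 x := by
  choose! g hg𝒰 hg using h.2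
  let merge (U : Set X) : Set X := ⋃₀ {V ∈ 𝒱 | g V = U}
  have merge_subset (U : Set X) : merge U ⊆ U :=
    sUnion_subset fun V ⟨hV, hVU⟩ => hVU ▸ hg V hV
  refine ⟨merge '' 𝒰, hfin.image _, ⟨?_, ?_⟩, fun x => ⟨?_, ?_⟩⟩
  · exact h.1.of_forall_exists_superset fun V hV =>
      ⟨merge (g V), mem_image_of_mem _ (hg𝒰 V hV), subset_sUnion_of_mem ⟨hV, rfl⟩⟩
  · exact forall_mem_image.2 fun U hU => ⟨U, hU, merge_subset U⟩
  · refine multiplicityAt_le_of_forall_exists_eq (merge ∘ g) ?_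
    rintro _ ⟨U, -, rfl⟩ ⟨V, ⟨hV, rfl⟩, hx⟩
    exact ⟨V, hV, hx, rfl⟩
  · refine multiplicityAt_le_of_forall_exists_eq merge ?_
    rintro _ ⟨U, hU, rfl⟩ hx
    exact ⟨U, hU, merge_subset U hx, rfl⟩

/-- Every finite coarse family in `X` has a coarse refinement of multiplicity at most `k` at the
points of `A`. This expresses the coarse dimension of `A` being at most `k - 1` through families
in the ambient space. -/
def HasCoarseRefinementsOn (A : Set X) (k : ℕ∞) : Prop :=
  ∀ 𝒰 : Set (Set X), 𝒰.Finite → IsCoarseFamily 𝒰 →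
    ∃ 𝒱, IsCoarseRefinement 𝒱 𝒰 ∧ ∀ x ∈ A, multiplicityAt 𝒱 x ≤ k

variable {A B : Set X} {k l : ℕ∞}

lemma HasCoarseRefinementsOn.mono (h : HasCoarseRefinementsOn A k) (hBA : B ⊆ A) (hkl : k ≤ l) :
    HasCoarseRefinementsOn B l := by
  intro 𝒰 hfin h𝒰
  obtain ⟨𝒱, h𝒱, hmult⟩ := h 𝒰 hfin h𝒰
  exact ⟨𝒱, h𝒱, fun x hx => (hmult x (hBA hx)).trans hkl⟩

lemma HasCoarseRefinementsOn.union (hA : HasCoarseRefinementsOn A k)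
    (hB : HasCoarseRefinementsOn B k) : HasCoarseRefinementsOn (A ∪ B) k := by
  intro 𝒰 hfin h𝒰
  obtain ⟨𝒱, h𝒱, hmultA⟩ := hA 𝒰 hfin h𝒰
  obtain ⟨𝒱', hfin', h𝒱', hmult'⟩ := h𝒱.exists_finite_multiplicityAt_le hfin
  obtain ⟨𝒲, h𝒲, hmultB⟩ := hB 𝒱' hfin' h𝒱'.1
  obtain ⟨𝒲', -, h𝒲', hmult''⟩ := h𝒲.exists_finite_multiplicityAt_le hfin'
  refine ⟨𝒲', h𝒲'.trans h𝒱', ?_⟩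
  rintro x (hx | hx)
  · exact (hmult'' x).2.trans <| (hmult' x).1.trans <| hmultA x hx
  · exact (hmult'' x).1.trans <| hmultB x hx

lemma hasCoarseRefinementsOn_union :
    HasCoarseRefinementsOn (A ∪ B) k ↔ HasCoarseRefinementsOn A k ∧ HasCoarseRefinementsOn B k :=
  ⟨fun h => ⟨h.mono subset_union_left le_rfl, h.mono subset_union_right le_rfl⟩,
    fun h => h.1.union h.2⟩

end Refinement

section Extension

variable {X Y : Type*} {f : Y → X} {g : Set Y → Set X} {𝒱 : Set (Set Y)} {𝒰 : Set (Set X)}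

/-- The extension to `X` of a family `𝒱` in `Y` along `f : Y → X`: outside the range of `f`, the
image of `V ∈ 𝒱` is enlarged by `g V`, and the traces of the members of `𝒰` are added to cover the
points that are far from the range. -/
def extendFamily (f : Y → X) (g : Set Y → Set X) (𝒱 : Set (Set Y)) (𝒰 : Set (Set X)) :
    Set (Set X) :=
  (fun V => f '' V ∪ (g V \ range f)) '' 𝒱 ∪ (fun U => U \ range f) '' 𝒰

lemma multiplicityAt_extendFamily_le (hf : f.Injective) (y : Y) :
    multiplicityAt (extendFamily f g 𝒱 𝒰) (f y) ≤ multiplicityAt 𝒱 y := by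
  refine multiplicityAt_le_of_forall_exists_eq (fun V => f '' V ∪ (g V \ range f)) ?_
  rintro _ (⟨V, hV, rfl⟩ | ⟨U, -, rfl⟩) hy
  · obtain hy | hy := hy
    · exact ⟨V, hV, hf.mem_set_image.1 hy, rfl⟩
    · exact absurd (mem_range_self y) hy.2
  · exact absurd (mem_range_self y) hy.2

end Extension

section Isometry

variable {X Y : Type*} [MetricSpace X] [MetricSpace Y] {f : Y → X} {𝒰 : Set (Set X)}
  {𝒱 : Set (Set Y)} {g : Set Y → Set X}

lemma eventually_forall_edist_lt_of_lipschitzWith {K : ℝ≥0} (hf : LipschitzWith K f)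
    {p : Y → Prop} (hp : ∀ᶠ y in cobounded Y, p y) (t : ℝ≥0) :
    ∀ᶠ x in cobounded X, ∀ y, edist x (f y) < t → p y := by
  have hbdd : IsBounded (thickening t (f '' {y | p y}ᶜ)) :=
    (hf.isBounded_image (isBounded_compl_iff.2 hp)).thickening
  filter_upwards [isBounded_def.1 hbdd] with x hx y hxy
  by_contra hpy
  refine hx ((mem_thickening_iff_exists_edist_lt _ _).2 ⟨f y, mem_image_of_mem f hpy, ?_⟩)
  rwa [ENNReal.ofReal_coe_nnreal]

lemma IsCoarseFamily.image_preimage (hf : Isometry f) (h𝒰 : IsCoarseFamily 𝒰) :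
    IsCoarseFamily (preimage f '' 𝒰) := by
  rw [isCoarseFamily_iff_eventually_eball_subset] at h𝒰 ⊢
  intro t
  filter_upwards [hf.antilipschitz.tendsto_cobounded.eventually (h𝒰 t)] with y ⟨U, hU, hball⟩
  refine ⟨_, mem_image_of_mem _ hU, ?_⟩
  rw [← hf.preimage_eball]
  exact preimage_mono hball

lemma eball_subset_image_union_sdiff (hf : Isometry f) {y : Y} {r : ℝ≥0∞} {V : Set Y} {W : Set X}
    (hV : eball y r ⊆ V) (hW : eball (f y) r ⊆ W) :
    eball (f y) r ⊆ f '' V ∪ (W \ range f) := by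
  intro z hz
  by_cases hzf : z ∈ range f
  · obtain ⟨w, rfl⟩ := hzf
    exact Or.inl (mem_image_of_mem f (hV (hf.preimage_eball y r ▸ hz)))
  · exact Or.inr ⟨hW hz, hzf⟩

lemma IsCoarseFamily.extendFamily (hf : Isometry f) (h𝒱 : IsCoarseFamily 𝒱)
    (h𝒰 : IsCoarseFamily 𝒰)
    (hg : ∀ t : ℝ≥0, ∀ᶠ y in cobounded Y, ∀ V ∈ 𝒱, y ∈ V → eball (f y) t ⊆ g V) :
    IsCoarseFamily (extendFamily f g 𝒱 𝒰) := by
  rw [isCoarseFamily_iff_eventually_eball_subset] at h𝒱 h𝒰 ⊢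
  intro t
  filter_upwards [h𝒰 t, eventually_forall_edist_lt_of_lipschitzWith hf.lipschitz
    ((h𝒱 (2 * t)).and (hg (2 * t))) t] with x ⟨U, hU, hxU⟩ hnear
  by_cases hx : ∃ y, edist x (f y) < t
  · obtain ⟨y, hxy⟩ := hx
    obtain ⟨⟨V, hV, hyV⟩, hdeep⟩ := hnear y hxy
    have hball : eball x t ⊆ eball (f y) (2 * t : ℝ≥0) := by
      refine eball_subset ?_ (edist_ne_top _ _)
      rw [ENNReal.coe_mul, ENNReal.coe_ofNat, two_mul]
      gcongr
    have hy : y ∈ V := by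
      refine hyV ?_
      rw [← hf.preimage_eball]
      exact hball (mem_eball'.2 hxy)
    exact ⟨_, Or.inl (mem_image_of_mem _ hV),
      hball.trans (eball_subset_image_union_sdiff hf hyV (hdeep V hV hy))⟩
  · refine ⟨_, Or.inr (mem_image_of_mem _ hU), fun z hz => ⟨hxU hz, ?_⟩⟩
    rintro ⟨y, rfl⟩
    exact hx ⟨y, mem_eball'.1 hz⟩

variable {k : ℕ∞}

lemma hasCoarseRefinementsOn_range (hf : Isometry f)
    (h : HasCoarseRefinementsOn (univ : Set Y) k) : HasCoarseRefinementsOn (range f) k := by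
  intro 𝒰 hfin h𝒰
  obtain ⟨𝒱, ⟨h𝒱, href⟩, hmult⟩ := h (preimage f '' (deepPart 𝒰 '' 𝒰)) ((hfin.image _).image _)
    ((h𝒰.image_deepPart hfin).image_preimage hf)
  simp only [exists_mem_image] at href
  choose! g hg𝒰 hg using href
  refine ⟨extendFamily f g 𝒱 𝒰, ⟨h𝒱.extendFamily hf h𝒰 fun t => ?_, ?_⟩, ?_⟩
  · filter_upwards [hf.antilipschitz.tendsto_cobounded.eventually
      (h𝒰.eventually_eball_subset_of_mem_deepPart t)] with y hy V hV hyV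
    exact hy (g V) (hg V hV hyV)
  · rintro _ (⟨V, hV, rfl⟩ | ⟨U, hU, rfl⟩)
    · have himage : f '' V ⊆ g V :=
        image_subset_iff.2 <| (hg V hV).trans (preimage_mono (deepPart_subset _))
      exact ⟨g V, hg𝒰 V hV, union_subset himage sdiff_subset⟩
    · exact ⟨U, hU, sdiff_subset⟩
  · rintro _ ⟨y, rfl⟩
    exact (multiplicityAt_extendFamily_le hf.injective y).trans (hmult y (mem_univ y))

lemma hasCoarseRefinementsOn_univ_of_range (hf : Isometry f)
    (h : HasCoarseRefinementsOn (range f) k) : HasCoarseRefinementsOn (univ : Set Y) k := by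
  intro 𝒰 hfin h𝒰
  obtain rfl | ⟨U₀, hU₀⟩ := 𝒰.eq_empty_or_nonempty
  · exact ⟨∅, ⟨h𝒰, by simp⟩, by simp [multiplicityAt]⟩
  have hcoarse : IsCoarseFamily (extendFamily f (fun _ => univ) 𝒰 {univ}) :=
    h𝒰.extendFamily hf isCoarseFamily_singleton_univ fun _ =>
      Eventually.of_forall fun _ _ _ _ => subset_univ _
  obtain ⟨𝒱, ⟨h𝒱, href⟩, hmult⟩ :=
    h _ ((hfin.image _).union ((finite_singleton _).image _)) hcoarse
  refine ⟨preimage f '' 𝒱, ⟨h𝒱.image_preimage hf, forall_mem_image.2 fun V hV => ?_⟩,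
    fun y _ => (multiplicityAt_image_preimage_le f y).trans (hmult _ (mem_range_self y))⟩
  obtain ⟨_, ⟨U, hU, rfl⟩ | ⟨_, -, rfl⟩, hVU⟩ := href V hV
  · refine ⟨U, hU, fun y hy => ?_⟩
    obtain hy | hy := hVU hy
    · exact hf.injective.mem_set_image.1 hy
    · exact absurd (mem_range_self y) hy.2
  · exact ⟨U₀, hU₀, fun y hy => absurd (mem_range_self y) (hVU hy).2⟩

lemma hasCoarseRefinementsOn_range_iff (hf : Isometry f) :
    HasCoarseRefinementsOn (range f) k ↔ HasCoarseRefinementsOn (univ : Set Y) k :=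
  ⟨hasCoarseRefinementsOn_univ_of_range hf, hasCoarseRefinementsOn_range hf⟩

end Isometry

section Dimension

variable {X : Type*} [MetricSpace X] {m n : ℤ}

lemma hasCoarseDimLE_iff :
    HasCoarseDimLE X n ↔
      0 ≤ n + 1 ∧ HasCoarseRefinementsOn (univ : Set X) ((n + 1).toNat : ℕ) := by
  simp only [HasCoarseDimLE, HasCoarseRefinementsOn, familyMultiplicity, iSup_le_iff, mem_univ,
    true_imp_iff]
  constructor
  · rintro ⟨k, hk, h⟩
    rw [← hk]
    exact ⟨Int.natCast_nonneg k, h⟩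
  · rintro ⟨hn, h⟩
    exact ⟨_, Int.toNat_of_nonneg hn, h⟩

lemma hasCoarseDimLE_coe_iff {A : Set X} :
    HasCoarseDimLE A n ↔ 0 ≤ n + 1 ∧ HasCoarseRefinementsOn A ((n + 1).toNat : ℕ) := by
  rw [hasCoarseDimLE_iff, ← hasCoarseRefinementsOn_range_iff isometry_subtype_coe,
    Subtype.range_coe]

lemma HasCoarseDimLE.mono (h : HasCoarseDimLE X m) (hmn : m ≤ n) : HasCoarseDimLE X n := by
  rw [hasCoarseDimLE_iff] at h ⊢
  exact ⟨by lia, h.2.mono subset_rfl (mod_cast Int.toNat_le_toNat (by gcongr))⟩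

lemma coarseDim_le_iff : coarseDim X ≤ m ↔ HasCoarseDimLE X m := by
  by_cases hne : ∃ n, HasCoarseDimLE X n
  · obtain ⟨n, hn, hmin⟩ := Int.exists_least_of_bdd (P := HasCoarseDimLE X)
      ⟨-1, fun z hz => by linarith [(hasCoarseDimLE_iff.1 hz).1]⟩ hne
    have hleast : IsLeast {d | ∃ n : ℤ, d = (n : WithTop ℤ) ∧ HasCoarseDimLE X n} n := by
      refine ⟨⟨n, rfl, hn⟩, ?_⟩
      rintro _ ⟨z, rfl, hz⟩
      exact WithTop.coe_le_coe.2 (hmin z hz)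
    rw [coarseDim, hleast.csInf_eq, WithTop.coe_le_coe]
    exact ⟨hn.mono, hmin m⟩
  · have htop : coarseDim X = ⊤ := by
      rw [coarseDim, ← WithTop.sInf_empty]
      congr 1
      exact eq_empty_of_forall_notMem fun _ ⟨n, _, hn⟩ => hne ⟨n, hn⟩
    simpa [htop] using fun h => hne ⟨m, h⟩

end Dimension

end CoarseUnion

theorem mainTheorem8 {X : Type*} [MetricSpace X] (A B : Set X) (hAB : A ∪ B = Set.univ) :
    CoarseUnion.coarseDim X = max (CoarseUnion.coarseDim A) (CoarseUnion.coarseDim B) := by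
  refine eq_of_forall_ge_iff fun c => ?_
  induction c using WithTop.recTopCoe with
  | top => simp only [le_top]
  | coe n =>
    simp only [max_le_iff, CoarseUnion.coarseDim_le_iff, CoarseUnion.hasCoarseDimLE_coe_iff]
    rw [CoarseUnion.hasCoarseDimLE_iff, ← hAB, CoarseUnion.hasCoarseRefinementsOn_union,
      and_and_left]
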